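/- For a finite field $\mathbb F_q$ (with $q$ any prime power) let $\mathbb H_1(\mathbb F_q)=\mathbb F_q^3$ with the group law $(x,y,t)\cdot(x',y',t')=(x+x',\,y+y',\,t+t'+xy'-yx')$. A horizontal line is a set $L=\{\mathbf p\cdot(sa,sb,0): s\in\mathbb F_q\}$ with $\mathbf p=(x_0,y_0,t_0)\in\mathbb H_1(\mathbb F_q)$ and $(a,b)\in\mathbb F_q^2\setminus\{(0,0)\}$; its refined direction is $\mathrm{Dir}(L)=[a:b:x_0b-y_0a]$, an element of $\mathcal D_1=\{[a:b:c]\in\mathbb P^2(\mathbb F_q):(a,b)\ne(0,0)\}$. For $F:\mathbb H_1(\mathbb F_q)\to\mathbb C$ and $\omega\in\mathcal D_1$ put $$(\mathcal M^{\mathrm{rd}}_{\mathbb H_1}F)(\omega)=\max_{L\text{ horizontal},\ \mathrm{Dir}(L)=\omega}\ \sum_{\mathbf p\in L}|F(\mathbf p)|.$$ All $\ell^p$ norms are taken with respect to counting measure. **Theorem.** Let $1\le u,v\le\infty$, with the convention $1/\infty=0$. Among all real numbers $A\ge 0$ for which there is a constant $C>0$ such that $$\|\mathcal M^{\mathrm{rd}}_{\mathbb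 H_1}F\|_{\ell^v(\mathcal D_1)}\le C\,q^{A}\,\|F\|_{\ell^u(\mathbb H_1(\mathbb F_q))}\qquad\text{for all prime powers } q \text{ and all } F:\mathbb H_1(\mathbb F_q)\to\mathbb C,$$ (so $C$ may depend on $u$, $v$ and $A$, but not on $q$ or $F$) there is a smallest one, $A^{\mathrm{rd}}_1(u,v)$, and $$A^{\mathrm{rd}}_1(u,v)=\max\Bigl(\frac1v,\ 1-\frac1u,\ \frac2v-\frac1u,\ 1+\frac2v-\frac3u\Bigr).$$ -/

import Mathlib

open scoped ENNReal

namespace HeisKakeya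

/-- The underlying set `K × K × K` of the first Heisenberg group over a field `K`. -/
@[ext]
structure Heis (K : Type*) where
  x : K
  y : K
  t : K

namespace Heis

variable {K : Type*} [Field K]

/-- The group law `(x,y,t)·(x',y',t') = (x+x', y+y', t+t'+(xy'-yx'))`. -/
instance : Mul (Heis K) :=
  ⟨fun p p' => ⟨p.x + p'.x, p.y + p'.y, p.t + p'.t + (p.x * p'.y - p.y * p'.x)⟩⟩

instance : One (Heis K) := ⟨⟨0, 0, 0⟩⟩

instance : Inv (Heis K) := ⟨fun p => ⟨-p.x, -p.y, -p.t⟩⟩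

@[simp] theorem mul_x (p p' : Heis K) : (p * p').x = p.x + p'.x := rfl

@[simp] theorem mul_y (p p' : Heis K) : (p * p').y = p.y + p'.y := rfl

@[simp] theorem mul_t (p p' : Heis K) :
    (p * p').t = p.t + p'.t + (p.x * p'.y - p.y * p'.x) := rfl

@[simp] theorem one_x : (1 : Heis K).x = 0 := rfl

@[simp] theorem one_y : (1 : Heis K).y = 0 := rfl

@[simp] theorem one_t : (1 : Heis K).t = 0 := rfl

@[simp] theorem inv_x (p : Heis K) : (p⁻¹).x = -p.x := rfl

@[simp] theorem inv_y (p : Heis K) : (p⁻¹).y = -p.y := rfl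

@[simp] theorem inv_t (p : Heis K) : (p⁻¹).t = -p.t := rfl

instance : Group (Heis K) :=
  Group.ofLeftAxioms
    (by intro p p' p''; ext <;> simp <;> ring)
    (by intro p; ext <;> simp)
    (by intro p; ext <;> simp; ring)

/-- The coordinate bijection with `K × K × K`. -/
def equivProd (K : Type*) : Heis K ≃ K × K × K where
  toFun p := (p.x, p.y, p.t)
  invFun w := ⟨w.1, w.2.1, w.2.2⟩
  left_inv _ := rfl
  right_inv _ := rfl

instance {K : Type*} [Finite K] : Finite (Heis K) := Finite.of_equiv _ (equivProd K).symm

end Heis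

section Lines

variable {K : Type*} [Field K]

/-- The horizontal line `{p·(sa, sb, 0) : s ∈ K}` through `p` in the direction `[a:b]`
(a genuine line only when `(a, b) ≠ (0, 0)`, which is imposed wherever it is used). -/
def horizontalLine (p : Heis K) (a b : K) : Set (Heis K) :=
  {z | ∃ s : K, z = p * ⟨s * a, s * b, 0⟩}

/-- The refined direction set `{[a:b:c] ∈ ℙ²(K) : (a, b) ≠ (0, 0)}`. -/
def refinedDirections (K : Type*) [Field K] : Set (Projectivization K (K × K × K)) :=
  {ω | ∃ (a b c : K) (h : (a, b, c) ≠ (0 : K × K × K)),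
    (a, b) ≠ (0 : K × K) ∧ ω = Projectivization.mk K (a, b, c) h}

/-- `L` is a horizontal line with `Dir(L) = ω`: for a point `p = (x₀, y₀, t₀)` and a direction
vector `(a, b) ≠ (0, 0)` of `L` one has `ω = [a : b : x₀ b - y₀ a]`. -/
def IsHorizontalLineWithDir (L : Set (Heis K)) (ω : Projectivization K (K × K × K)) : Prop :=
  ∃ (p : Heis K) (a b : K) (h : (a, b, p.x * b - p.y * a) ≠ (0 : K × K × K)),
    (a, b) ≠ (0 : K × K) ∧ L = horizontalLine p a b ∧
      ω = Projectivization.mk K (a, b, p.x * b - p.y * a) h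

/-- The refined direction of a horizontal line depends only on the line as a set. -/
theorem IsHorizontalLineWithDir.unique {L : Set (Heis K)}
    {ω ω' : Projectivization K (K × K × K)}
    (h : IsHorizontalLineWithDir L ω) (h' : IsHorizontalLineWithDir L ω') : ω = ω' := by
  obtain ⟨p, a, b, h0, hab, rfl, rfl⟩ := h
  obtain ⟨p', a', b', h0', hab', hL, rfl⟩ := h'
  have m0 : p ∈ horizontalLine p' a' b' := by
    rw [← hL]; exact ⟨0, by ext <;> simp⟩
  have m1 : p * ⟨a, b, 0⟩ ∈ horizontalLine p' a' b' := by
    rw [← hL]; exact ⟨1, by simp⟩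
  obtain ⟨s, hs⟩ := m0
  obtain ⟨r, hr⟩ := m1
  have hx := congrArg Heis.x hs
  have hy := congrArg Heis.y hs
  have hx1 := congrArg Heis.x hr
  have hy1 := congrArg Heis.y hr
  simp only [Heis.mul_x, Heis.mul_y] at hx hy hx1 hy1
  have ha : a = (r - s) * a' := by linear_combination hx1 - hx
  have hb : b = (r - s) * b' := by linear_combination hy1 - hy
  rw [Projectivization.mk_eq_mk_iff']
  refine ⟨r - s, ?_⟩
  simp only [Prod.smul_mk, smul_eq_mul, Prod.mk.injEq]
  refine ⟨ha.symm, hb.symm, ?_⟩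
  rw [hx, hy, ha, hb]
  ring

/-- Every element of the refined direction set is the refined direction of a horizontal line. -/
theorem exists_isHorizontalLineWithDir {ω : Projectivization K (K × K × K)}
    (hω : ω ∈ refinedDirections K) : ∃ L, IsHorizontalLineWithDir L ω := by
  obtain ⟨a, b, c, h, hab, rfl⟩ := hω
  obtain ⟨p, hp⟩ : ∃ p : Heis K, p.x * b - p.y * a = c := by
    by_cases hb : b = 0
    · have ha : a ≠ 0 := by
        rintro rfl
        exact hab (by simp [hb])
      exact ⟨⟨0, -(c / a), 0⟩, by field_simp; simp⟩
    · exact ⟨⟨c / b, 0, 0⟩, by field_simp; simp⟩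
  subst hp
  exact ⟨_, p, a, b, h, hab, rfl, rfl⟩

/-- The refined-direction maximal operator: the maximum, over all horizontal lines `L` with
`Dir(L) = ω`, of `∑_{p ∈ L} |F p|`. For finite `K` this is a supremum over a finite nonempty set
of real numbers, hence a maximum. -/
noncomputable def maximalRd (F : Heis K → ℂ) (ω : refinedDirections K) : ℝ :=
  sSup {r : ℝ | ∃ L : Set (Heis K), IsHorizontalLineWithDir L ω.1 ∧ r = ∑ᶠ p ∈ L, ‖F p‖}

/-- Over a finite field the supremum that defines `maximalRd` is attained. -/
theorem maximalRd_isGreatest [Finite K] (F : Heis K → ℂ) (ω : refinedDirections K) :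
    IsGreatest {r : ℝ | ∃ L : Set (Heis K), IsHorizontalLineWithDir L ω.1 ∧
      r = ∑ᶠ p ∈ L, ‖F p‖} (maximalRd F ω) := by
  have hfin : {r : ℝ | ∃ L : Set (Heis K), IsHorizontalLineWithDir L ω.1 ∧
      r = ∑ᶠ p ∈ L, ‖F p‖}.Finite :=
    (Set.finite_range fun L : Set (Heis K) => ∑ᶠ p ∈ L, ‖F p‖).subset
      (by rintro r ⟨L, -, rfl⟩; exact ⟨L, rfl⟩)
  have hne : {r : ℝ | ∃ L : Set (Heis K), IsHorizontalLineWithDir L ω.1 ∧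
      r = ∑ᶠ p ∈ L, ‖F p‖}.Nonempty := by
    obtain ⟨L, hL⟩ := exists_isHorizontalLineWithDir ω.2
    exact ⟨_, L, hL, rfl⟩
  exact ⟨hne.csSup_mem hfin, fun r hr => le_csSup hfin.bddAbove hr⟩

end Lines

/-- The `ℓ^p` norm (`1 ≤ p ≤ ∞`) with respect to counting measure of a function on a finite set. -/
noncomputable def ellNorm {X : Type*} [Finite X] {E : Type*} [NormedAddCommGroup E]
    (p : ℝ≥0∞) (f : X → E) : ℝ :=
  letI : Fintype X := Fintype.ofFinite X
  ‖(WithLp.toLp p f : PiLp p fun _ : X => E)‖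

instance {K : Type*} [Field K] [Finite K] : Finite (refinedDirections K) := by
  have : Finite (Projectivization K (K × K × K)) := by
    unfold Projectivization
    infer_instance
  infer_instance

/-- `A` is an admissible growth exponent from `ℓ^u` to `ℓ^v`: there is a constant `C > 0`,
independent of the finite field and of the function, such that
`‖M^rd F‖_{ℓ^v(D₁)} ≤ C q^A ‖F‖_{ℓ^u(H₁(𝔽_q))}` for every finite field and every `F`. -/
def IsGrowthExponent (u v : ℝ≥0∞) (A : ℝ) : Prop :=
  ∃ C : ℝ, 0 < C ∧ ∀ (K : Type) [Field K] [Finite K] (F : Heis K → ℂ),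
    ellNorm v (maximalRd F) ≤ C * (Nat.card K : ℝ) ^ A * ellNorm u F

end HeisKakeya

/-!
The horizontal lines with a given refined direction are the `q` lifts of one line of the affine
plane, so the maximal function is a maximum over selections of one lift for each of the `q² + q`
lines of the plane. Everything rests on one estimate (`LineSelection.sum_lineSum_sq_le`): for every
selection, `∑ ω, (∑ p ∈ L ω, f p)² ≤ 12 q ∑ p, f p²`.

The points and horizontal lines form the affine part of a symplectic generalized quadrangle.
Let `H` be convolution with the horizontal plane `{(a, b, 0)}`. Then
`‖H f‖² = q² ‖f‖² + q (∑ f)² - (a nonnegative term)` (`sum_sq_sum_horiz`), so `H` has norm at most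
`q` on functions of mean zero. Since the sum over all lines of `(∑ p ∈ L, f p)²` is
`q ‖f‖² + ⟨f, H f⟩`, the estimate holds for mean-zero `f` even when summed over all lines
(`sum_sq_sum_line_le`). For constant `f` it holds because only `O(q²)` lines are selected.
The argument works in every characteristic.

Hölder's inequality along the lines combines this with the trivial bounds `ℓ^∞ → ℓ^∞`, `ℓ¹ → ℓ¹`
and `ℓ¹ → ℓ^∞`. It gives the sharp exponents on the diagonal `u = v` and on the segment
`1/u + 1/v = 1`, `u ≤ 2`; comparing `ℓ^p` norms on finite sets gives all other pairs
(`isGrowthExponent_max`). The lower bounds (`max_le_of_isGrowthExponent`) come from the indicator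
functions of a point, of a line (in two ways) and of the whole group.
-/

namespace HeisKakeya

/-! ### Norms on finite sets -/

/-- Hölder's inequality in log-convex form. -/
theorem sum_rpow_mul_rpow_le {ι : Type*} (s : Finset ι) {a b : ι → ℝ} (ha : ∀ i, 0 ≤ a i)
    (hb : ∀ i, 0 ≤ b i) {θ : ℝ} (h0 : 0 ≤ θ) (h1 : θ ≤ 1) :
    ∑ i ∈ s, a i ^ θ * b i ^ (1 - θ) ≤ (∑ i ∈ s, a i) ^ θ * (∑ i ∈ s, b i) ^ (1 - θ) := by
  rcases h0.eq_or_lt with rfl | h0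
  · simp
  rcases h1.eq_or_lt with rfl | h1
  · simp
  have hc : (θ⁻¹).HolderConjugate (1 - θ)⁻¹ := by
    rw [Real.holderConjugate_iff]
    exact ⟨(one_lt_inv₀ h0).2 h1, by simp⟩
  have h := Real.inner_le_Lp_mul_Lq_of_nonneg s hc
    (fun i _ => Real.rpow_nonneg (ha i) θ) (fun i _ => Real.rpow_nonneg (hb i) (1 - θ))
  have h1' : 1 - θ ≠ 0 := by linarith
  simpa only [one_div, inv_inv, ← Real.rpow_mul (ha _), ← Real.rpow_mul (hb _),
    mul_inv_cancel₀ h0.ne', mul_inv_cancel₀ h1', Real.rpow_one] using h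

theorem sum_comp_le_sum_of_injective {ι X : Type*} [Fintype ι] [Fintype X] {e : ι → X}
    (he : Function.Injective e) {g : X → ℝ} (hg : ∀ x, 0 ≤ g x) : ∑ i, g (e i) ≤ ∑ x, g x :=
  calc ∑ i, g (e i) = ∑ x ∈ Finset.univ.map ⟨e, he⟩, g x := by simp
    _ ≤ ∑ x, g x :=
        Finset.sum_le_sum_of_subset_of_nonneg (Finset.subset_univ _) fun _ _ _ => hg _

section ellNorm

variable {X : Type*} [Finite X] {E : Type*} [NormedAddCommGroup E]

theorem ellNorm_eq_sum [i : Fintype X] {p : ℝ≥0∞} (hp : 1 ≤ p) (hp' : p ≠ ∞) (f : X → E) :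
    ellNorm p f = (∑ x, ‖f x‖ ^ p.toReal) ^ (1 / p.toReal) := by
  obtain rfl : i = Fintype.ofFinite X := Subsingleton.elim _ _
  let := Fintype.ofFinite X
  exact PiLp.norm_eq_sum (ENNReal.toReal_pos (zero_lt_one.trans_le hp).ne' hp') _

theorem ellNorm_top (f : X → E) : ellNorm ∞ f = ⨆ x, ‖f x‖ := rfl

theorem ellNorm_nonneg {p : ℝ≥0∞} (hp : 1 ≤ p) (f : X → E) : 0 ≤ ellNorm p f := by
  have := Fintype.ofFinite X
  by_cases hp' : p = ∞
  · subst hp'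
    rw [ellNorm_top]
    exact Real.iSup_nonneg fun _ => norm_nonneg _
  · rw [ellNorm_eq_sum hp hp']
    positivity

theorem ellNorm_rpow [Fintype X] {p : ℝ≥0∞} (hp : 1 ≤ p) (hp' : p ≠ ∞) (f : X → E) :
    ellNorm p f ^ p.toReal = ∑ x, ‖f x‖ ^ p.toReal := by
  have : 0 < p.toReal := ENNReal.toReal_pos (zero_lt_one.trans_le hp).ne' hp'
  rw [ellNorm_eq_sum hp hp', ← Real.rpow_mul (by positivity), one_div, inv_mul_cancel₀ this.ne',
    Real.rpow_one]

theorem ellNorm_le_of_sum_rpow_le [Fintype X] {p : ℝ≥0∞} (hp : 1 ≤ p) (hp' : p ≠ ∞) {f : X → E}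
    {B : ℝ} (hB : 0 ≤ B) (h : ∑ x, ‖f x‖ ^ p.toReal ≤ B ^ p.toReal) : ellNorm p f ≤ B := by
  have : 0 < p.toReal := ENNReal.toReal_pos (zero_lt_one.trans_le hp).ne' hp'
  rw [← ellNorm_rpow hp hp'] at h
  exact (Real.rpow_le_rpow_iff (ellNorm_nonneg hp f) hB this).1 h

theorem norm_le_ellNorm {p : ℝ≥0∞} (hp : 1 ≤ p) (f : X → E) (x : X) : ‖f x‖ ≤ ellNorm p f := by
  have := Fintype.ofFinite X
  by_cases hp' : p = ∞
  · subst hp'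
    rw [ellNorm_top]
    exact le_ciSup (f := fun x => ‖f x‖) (Set.finite_range _).bddAbove x
  · have h0 : 0 < p.toReal := ENNReal.toReal_pos (zero_lt_one.trans_le hp).ne' hp'
    rw [← Real.rpow_le_rpow_iff (norm_nonneg _) (ellNorm_nonneg hp f) h0, ellNorm_rpow hp hp']
    exact Finset.single_le_sum (f := fun x => ‖f x‖ ^ p.toReal) (fun _ _ => by positivity)
      (Finset.mem_univ x)

/-- For counting measure the `ℓ^p` norm decreases in `p`. -/
theorem ellNorm_anti {p q : ℝ≥0∞} (hp : 1 ≤ p) (hpq : p ≤ q) (f : X → E) :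
    ellNorm q f ≤ ellNorm p f := by
  have := Fintype.ofFinite X
  by_cases hq' : q = ∞
  · subst hq'
    rw [ellNorm_top]
    exact Real.iSup_le (norm_le_ellNorm hp f) (ellNorm_nonneg hp f)
  · have hp' : p ≠ ∞ := ne_top_of_le_ne_top hq' hpq
    have h0 : 0 < p.toReal := ENNReal.toReal_pos (zero_lt_one.trans_le hp).ne' hp'
    have h1 : p.toReal ≤ q.toReal := ENNReal.toReal_mono hq' hpq
    refine ellNorm_le_of_sum_rpow_le (hp.trans hpq) hq' (ellNorm_nonneg hp f) ?_
    have key : ∀ a : ℝ, 0 ≤ a → a ^ q.toReal = a ^ p.toReal * a ^ (q.toReal - p.toReal) := by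
      intro a ha
      rw [← Real.rpow_add_of_nonneg ha h0.le (by linarith)]
      ring_nf
    rw [key _ (ellNorm_nonneg hp f), ellNorm_rpow hp hp', Finset.sum_mul]
    refine Finset.sum_le_sum fun x _ => ?_
    rw [key _ (norm_nonneg _)]
    gcongr
    exact norm_le_ellNorm hp f x

/-- Hölder's inequality for the `ℓ^p` norms on a finite set. -/
theorem ellNorm_le_card_rpow_mul {p q : ℝ≥0∞} (hp : 1 ≤ p) (hpq : p ≤ q) (f : X → E) :
    ellNorm p f ≤ (Nat.card X : ℝ) ^ ((p⁻¹).toReal - (q⁻¹).toReal) * ellNorm q f := by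
  have := Fintype.ofFinite X
  by_cases hp' : p = ∞
  · subst hp'
    rw [top_le_iff] at hpq
    simp [hpq]
  have h0 : 0 < p.toReal := ENNReal.toReal_pos (zero_lt_one.trans_le hp).ne' hp'
  have hN := ellNorm_nonneg (hp.trans hpq) f
  refine ellNorm_le_of_sum_rpow_le hp hp' (by positivity) ?_
  rw [Real.mul_rpow (by positivity) hN, ← Real.rpow_mul (by positivity), ENNReal.toReal_inv,
    ENNReal.toReal_inv, sub_mul, inv_mul_cancel₀ h0.ne', Nat.card_eq_fintype_card]
  by_cases hq' : q = ∞
  · have : ∀ x ∈ Finset.univ, ‖f x‖ ^ p.toReal ≤ ellNorm q f ^ p.toReal := fun x _ =>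
      Real.rpow_le_rpow (norm_nonneg _) (norm_le_ellNorm (hp.trans hpq) f x) h0.le
    simpa [hq'] using Finset.sum_le_sum this
  · have h1 : p.toReal ≤ q.toReal := ENNReal.toReal_mono hq' hpq
    have hq0 : 0 < q.toReal := h0.trans_le h1
    have hr : 1 ≤ q.toReal / p.toReal := (one_le_div h0).2 h1
    have h := Real.rpow_sum_le_const_mul_sum_rpow_of_nonneg (s := Finset.univ)
      (f := fun x => ‖f x‖ ^ p.toReal) hr (fun _ _ => by positivity)
    simp only [← Real.rpow_mul (norm_nonneg _), mul_div_cancel₀ _ h0.ne', Finset.card_univ] at h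
    rw [← ellNorm_rpow (hp.trans hpq) hq'] at h
    have h2 := Real.rpow_le_rpow (by positivity) h (z := p.toReal / q.toReal) (by positivity)
    rw [← Real.rpow_mul (by positivity), Real.mul_rpow (by positivity) (by positivity),
      ← Real.rpow_mul (by positivity), ← Real.rpow_mul hN] at h2
    have e1 : q.toReal / p.toReal * (p.toReal / q.toReal) = 1 := by field_simp
    have e2 : (q.toReal / p.toReal - 1) * (p.toReal / q.toReal)
        = 1 - (q.toReal)⁻¹ * p.toReal := by field_simp
    have e3 : q.toReal * (p.toReal / q.toReal) = p.toReal := by field_simp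
    rwa [e1, e2, e3, Real.rpow_one] at h2

theorem mul_card_rpow_le_ellNorm {p : ℝ≥0∞} (hp : 1 ≤ p) {ι : Type*} [Finite ι] [Nonempty ι]
    {e : ι → X} (he : Function.Injective e) {f : X → E} {c : ℝ} (hc : 0 ≤ c)
    (h : ∀ i, c ≤ ‖f (e i)‖) : c * (Nat.card ι : ℝ) ^ (p⁻¹).toReal ≤ ellNorm p f := by
  have := Fintype.ofFinite X
  have := Fintype.ofFinite ι
  by_cases hp' : p = ∞
  · obtain ⟨i⟩ := ‹Nonempty ι›
    simpa [hp'] using (h i).trans (norm_le_ellNorm le_top f (e i))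
  · have h0 : 0 < p.toReal := ENNReal.toReal_pos (zero_lt_one.trans_le hp).ne' hp'
    rw [← Real.rpow_le_rpow_iff (by positivity) (ellNorm_nonneg hp f) h0, ellNorm_rpow hp hp',
      Real.mul_rpow hc (by positivity), ← Real.rpow_mul (by positivity), ENNReal.toReal_inv,
      inv_mul_cancel₀ h0.ne', Real.rpow_one]
    calc c ^ p.toReal * (Nat.card ι : ℝ) = ∑ _i : ι, c ^ p.toReal := by
          simp [mul_comm]
      _ ≤ ∑ i, ‖f (e i)‖ ^ p.toReal :=
          Finset.sum_le_sum fun i _ => Real.rpow_le_rpow hc (h i) h0.le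
      _ ≤ ∑ x, ‖f x‖ ^ p.toReal :=
          sum_comp_le_sum_of_injective he (g := fun x => ‖f x‖ ^ p.toReal) fun _ => by positivity

theorem ellNorm_indicator_one_le {p : ℝ≥0∞} (hp : 1 ≤ p) (S : Set X) :
    ellNorm p (S.indicator (1 : X → ℂ)) ≤ (S.ncard : ℝ) ^ (p⁻¹).toReal := by
  classical
  have := Fintype.ofFinite X
  by_cases hp' : p = ∞
  · subst hp'
    rw [ellNorm_top]
    refine Real.iSup_le (fun x => ?_) (by simp)
    by_cases hx : x ∈ S <;> simp [hx]
  · have h0 : 0 < p.toReal := ENNReal.toReal_pos (zero_lt_one.trans_le hp).ne' hp'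
    refine ellNorm_le_of_sum_rpow_le hp hp' (by positivity) ?_
    rw [← Real.rpow_mul (by positivity), ENNReal.toReal_inv, inv_mul_cancel₀ h0.ne', Real.rpow_one,
      Set.ncard_eq_toFinset_card']
    have : ∀ x, ‖S.indicator (1 : X → ℂ) x‖ ^ p.toReal = if x ∈ S then 1 else 0 := by
      intro x
      by_cases hx : x ∈ S <;> simp [hx, h0.ne']
    simp only [this, Finset.sum_boole, Set.toFinset]
    simp [Fintype.card_subtype]

end ellNorm

/-! ### Convolution with the horizontal plane -/

/-- The element `(a, b, 0)` of the Heisenberg group attached to `h = (a, b)`. -/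
def horiz {K : Type*} [Field K] (h : K × K) : Heis K := ⟨h.1, h.2, 0⟩

section Group

variable {K : Type*} [Field K]

theorem horiz_zero : horiz (0 : K × K) = 1 := rfl

theorem horiz_smul_inv_mul (r s : K) (h : K × K) :
    (horiz (r • h))⁻¹ * horiz (s • h) = horiz ((s - r) • h) := by
  ext <;> simp [horiz] <;> ring

theorem horiz_inv_mul_horiz_add (h k : K × K) :
    (horiz h)⁻¹ * horiz (h + k) = ⟨k.1, k.2, h.2 * k.1 - h.1 * k.2⟩ := by
  ext <;> simp [horiz]
  ring

theorem horizontalLine_eq_range (p : Heis K) (a b : K) :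
    horizontalLine p a b = Set.range fun s : K => p * horiz (s • (a, b)) := by
  ext z
  simp [horizontalLine, horiz, eq_comm]

theorem injective_mul_horiz_smul (p : Heis K) {h : K × K} (hh : h ≠ 0) :
    Function.Injective fun s : K => p * horiz (s • h) := by
  intro s s' hs
  have h1 := mul_left_cancel hs
  have h2 : s • h = s' • h := Prod.ext (congrArg Heis.x h1) (congrArg Heis.y h1)
  exact smul_left_injective K hh h2

theorem finsum_mem_horizontalLine [Fintype K] (f : Heis K → ℝ) (p : Heis K) {h : K × K}
    (hh : h ≠ 0) : ∑ᶠ z ∈ horizontalLine p h.1 h.2, f z = ∑ s : K, f (p * horiz (s • h)) := by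
  rw [horizontalLine_eq_range, finsum_mem_range (injective_mul_horiz_smul p hh),
    finsum_eq_sum_of_fintype]

end Group

section Autocorrelation

variable {K : Type*} [Field K]

/-- The autocorrelation `g ↦ ∑ p, F p * F (p * g)` of a real function on the Heisenberg group. -/
def autocorr [Fintype (Heis K)] (F : Heis K → ℝ) (g : Heis K) : ℝ := ∑ p, F p * F (p * g)

theorem autocorr_one [Fintype (Heis K)] (F : Heis K → ℝ) : autocorr F 1 = ∑ p, F p ^ 2 := by
  simp [autocorr, sq]

theorem sum_mul_translate [Fintype (Heis K)] (F : Heis K → ℝ) (a b : Heis K) :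
    ∑ p, F (p * a) * F (p * b) = autocorr F (a⁻¹ * b) :=
  Fintype.sum_equiv (Equiv.mulRight a) _ _ fun p => by simp [mul_assoc]

theorem sum_sum_sq_eq_sum_autocorr [Fintype (Heis K)] {ι : Type*} [Fintype ι]
    (F : Heis K → ℝ) (e : ι → Heis K) :
    ∑ p, (∑ i, F (p * e i)) ^ 2 = ∑ i, ∑ j, autocorr F ((e i)⁻¹ * e j) := by
  simp only [sq, Finset.sum_mul_sum, ← sum_mul_translate]
  rw [Finset.sum_comm]
  exact Finset.sum_congr rfl fun i _ => Finset.sum_comm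

theorem sum_autocorr [Fintype (Heis K)] (F : Heis K → ℝ) : ∑ g, autocorr F g = (∑ p, F p) ^ 2 := by
  simp only [autocorr, sq]
  rw [Finset.sum_comm, Finset.sum_mul_sum]
  refine Finset.sum_congr rfl fun p _ => ?_
  exact Fintype.sum_equiv (Equiv.mulLeft p) _ _ fun g => by simp

theorem sum_autocorr_horiz [Fintype K] [Fintype (Heis K)] (F : Heis K → ℝ) :
    ∑ h, autocorr F (horiz h) = ∑ p, F p * ∑ h, F (p * horiz h) := by
  simp only [autocorr, Finset.mul_sum]
  exact Finset.sum_comm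

/-- Up to the factor `q` this is the square norm of the sums of `F` over the vertical lines. -/
theorem sum_autocorr_center_nonneg [Fintype K] [Fintype (Heis K)] (F : Heis K → ℝ) :
    0 ≤ ∑ t : K, autocorr F ⟨0, 0, t⟩ := by
  have h : ∑ p, (∑ t : K, F (p * ⟨0, 0, t⟩)) ^ 2
      = (Fintype.card K : ℝ) * ∑ t : K, autocorr F ⟨0, 0, t⟩ := by
    rw [sum_sum_sq_eq_sum_autocorr]
    have : ∀ t : K, ∑ t', autocorr F ((⟨0, 0, t⟩ : Heis K)⁻¹ * ⟨0, 0, t'⟩)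
        = ∑ t', autocorr F ⟨0, 0, t'⟩ := fun t =>
      Fintype.sum_equiv (Equiv.addLeft (-t)) _ _ fun t' => by
        congr 1
        ext <;> simp
    simp [this]
  have hq : (0 : ℝ) < Fintype.card K := by exact_mod_cast Fintype.card_pos
  have h0 : 0 ≤ ∑ p, (∑ t : K, F (p * ⟨0, 0, t⟩)) ^ 2 := by positivity
  rw [h] at h0
  exact nonneg_of_mul_nonneg_right h0 hq

/-- A nonzero linear form on `K²` takes every value `q` times. -/
theorem sum_comp_symplectic [Fintype K] {k : K × K} (hk : k ≠ 0) (φ : K → ℝ) :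
    ∑ h : K × K, φ (h.2 * k.1 - h.1 * k.2) = Fintype.card K * ∑ t, φ t := by
  by_cases hk1 : k.1 = 0
  · have hk2 : k.2 ≠ 0 := fun h => hk (Prod.ext hk1 h)
    rw [Fintype.sum_prod_type_right]
    have : ∀ y : K, ∑ x : K, φ (y * k.1 - x * k.2) = ∑ t, φ t := fun y =>
      Fintype.sum_equiv ((Equiv.mulRight₀ k.2 hk2).trans (Equiv.subLeft (y * k.1))) _ _
        fun x => rfl
    simp [this]
  · rw [Fintype.sum_prod_type]
    have : ∀ x : K, ∑ y : K, φ (y * k.1 - x * k.2) = ∑ t, φ t := fun x =>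
      Fintype.sum_equiv ((Equiv.mulRight₀ k.1 hk1).trans (Equiv.subRight (x * k.2))) _ _
        fun y => rfl
    simp [this]

/-- The generalized quadrangle identity: two points with different projections to the plane have
exactly `q` common neighbours, and two distinct points of a vertical line have none. Here every
point counts as its own neighbour. -/
theorem sum_sq_sum_horiz [Fintype K] [Fintype (Heis K)] (F : Heis K → ℝ) :
    ∑ p, (∑ h, F (p * horiz h)) ^ 2
      = (Fintype.card K : ℝ) ^ 2 * ∑ p, F p ^ 2 + Fintype.card K * (∑ p, F p) ^ 2
        - Fintype.card K * ∑ t : K, autocorr F ⟨0, 0, t⟩ := by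
  classical
  have h1 : ∀ h : K × K, ∑ h', autocorr F ((horiz h)⁻¹ * horiz h')
      = ∑ k : K × K, autocorr F ⟨k.1, k.2, h.2 * k.1 - h.1 * k.2⟩ := fun h =>
    (Fintype.sum_equiv (Equiv.addLeft h) _ _ fun k => by
      rw [Equiv.coe_addLeft, horiz_inv_mul_horiz_add]).symm
  have h2 : ∀ k : K × K, ∑ h : K × K, autocorr F ⟨k.1, k.2, h.2 * k.1 - h.1 * k.2⟩
      = (Fintype.card K : ℝ) * ∑ t, autocorr F ⟨k.1, k.2, t⟩
        + if k = 0 then (Fintype.card K : ℝ) ^ 2 * ∑ p, F p ^ 2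
          - Fintype.card K * ∑ t : K, autocorr F ⟨0, 0, t⟩ else 0 := by
    intro k
    split_ifs with hk
    · subst hk
      have : autocorr F ⟨0, 0, 0⟩ = ∑ p, F p ^ 2 := autocorr_one F
      simp [this, sq]
    · rw [sum_comp_symplectic hk fun t => autocorr F ⟨k.1, k.2, t⟩, add_zero]
  have h3 : ∑ k : K × K, ∑ t, autocorr F ⟨k.1, k.2, t⟩ = (∑ p, F p) ^ 2 := by
    rw [← sum_autocorr, Fintype.sum_equiv (Heis.equivProd K) (fun g => autocorr F g)
      (fun w => autocorr F ⟨w.1, w.2.1, w.2.2⟩) fun g => rfl]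
    simp only [Fintype.sum_prod_type]
  rw [sum_sum_sq_eq_sum_autocorr]
  simp only [h1]
  rw [Finset.sum_comm]
  simp only [h2, Finset.sum_add_distrib, ← Finset.mul_sum, h3, Finset.sum_ite_eq',
    Finset.mem_univ, if_true]
  ring

/-- Convolution with the horizontal plane has norm at most `q` on functions of mean zero. -/
theorem sum_autocorr_horiz_le [Fintype K] [Fintype (Heis K)] {F : Heis K → ℝ} (hF : ∑ p, F p = 0) :
    ∑ h, autocorr F (horiz h) ≤ Fintype.card K * ∑ p, F p ^ 2 := by
  have hS : 0 ≤ ∑ p, F p ^ 2 := by positivity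
  rw [sum_autocorr_horiz]
  refine abs_le_of_sq_le_sq' ?_ (by positivity) |>.2
  refine (Finset.sum_mul_sq_le_sq_mul_sq _ _ _).trans ?_
  have hc := sum_autocorr_center_nonneg F
  have : ∑ p, (∑ h, F (p * horiz h)) ^ 2 ≤ (Fintype.card K : ℝ) ^ 2 * ∑ p, F p ^ 2 := by
    rw [sum_sq_sum_horiz, hF]
    have : 0 ≤ (Fintype.card K : ℝ) * ∑ t : K, autocorr F ⟨0, 0, t⟩ := by positivity
    linarith
  calc _ ≤ (∑ p, F p ^ 2) * ((Fintype.card K : ℝ) ^ 2 * ∑ p, F p ^ 2) := by gcongr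
    _ = _ := by ring

/-- Square function bound for mean-zero functions, over all parametrized horizontal lines (the
degenerate direction `h = 0` included). -/
theorem sum_sq_sum_line_le [Fintype K] [Fintype (Heis K)] {F : Heis K → ℝ} (hF : ∑ p, F p = 0) :
    ∑ p, ∑ h : K × K, (∑ s : K, F (p * horiz (s • h))) ^ 2
      ≤ 2 * (Fintype.card K : ℝ) ^ 3 * ∑ p, F p ^ 2 := by
  classical
  have hS : 0 ≤ ∑ p, F p ^ 2 := by positivity
  have hq : (1 : ℝ) ≤ Fintype.card K := by exact_mod_cast Fintype.card_pos
  -- dilating by `s - r ≠ 0` permutes the horizontal plane, so only `r = s` is exceptional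
  have h1 : ∀ r s : K, ∑ h : K × K, autocorr F (horiz ((s - r) • h))
      = (∑ h, autocorr F (horiz h)) + if r = s then (Fintype.card K : ℝ) ^ 2 * ∑ p, F p ^ 2
          - ∑ h, autocorr F (horiz h) else 0 := by
    intro r s
    split_ifs with hrs
    · simp [hrs, horiz_zero, autocorr_one, sq]
    · rw [add_zero]
      exact Fintype.sum_equiv (MulAction.toPerm (Units.mk0 (s - r) (sub_ne_zero.2 (Ne.symm hrs))))
        _ _ fun h => rfl
  rw [Finset.sum_comm]
  simp only [sum_sum_sq_eq_sum_autocorr, horiz_smul_inv_mul]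
  rw [Finset.sum_comm]
  have h2 : ∀ r : K, ∑ h : K × K, ∑ s, autocorr F (horiz ((s - r) • h))
      = (Fintype.card K - 1 : ℝ) * (∑ h, autocorr F (horiz h))
        + (Fintype.card K : ℝ) ^ 2 * ∑ p, F p ^ 2 := by
    intro r
    rw [Finset.sum_comm]
    simp only [h1, Finset.sum_add_distrib, Finset.sum_ite_eq, Finset.mem_univ, if_true,
      Finset.sum_const, Finset.card_univ, nsmul_eq_mul]
    ring
  simp only [h2, Finset.sum_const, Finset.card_univ, nsmul_eq_mul]
  have h3 := mul_le_mul_of_nonneg_left (sum_autocorr_horiz_le hF) (sub_nonneg.2 hq)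
  have h4 : 0 ≤ (Fintype.card K : ℝ) ^ 2 * ∑ p, F p ^ 2 := by positivity
  nlinarith [mul_le_mul_of_nonneg_left h3 (by positivity : 0 ≤ (Fintype.card K : ℝ))]

end Autocorrelation

/-! ### Sums along a selection of lines, one for each refined direction -/

/-- A choice of one horizontal line for every refined direction, recorded by a base point and a
direction vector of the line. -/
structure LineSelection (K : Type*) [Field K] where
  base : refinedDirections K → Heis K
  dir : refinedDirections K → K × K
  dir_ne_zero : ∀ ω, dir ω ≠ 0
  eq_mk : ∀ ω, ∃ h, ω.1 = Projectivization.mk K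
    ((dir ω).1, (dir ω).2, (base ω).x * (dir ω).2 - (base ω).y * (dir ω).1) h

namespace LineSelection

variable {K : Type*} [Field K]

/-- The sum of `f` over the line selected for the direction `ω`. -/
def lineSum [Fintype K] (σ : LineSelection K) (f : Heis K → ℝ) (ω : refinedDirections K) : ℝ :=
  ∑ s : K, f (σ.base ω * horiz (s • σ.dir ω))

theorem lineSum_nonneg [Fintype K] (σ : LineSelection K) {f : Heis K → ℝ} (hf : ∀ p, 0 ≤ f p)
    (ω : refinedDirections K) : 0 ≤ σ.lineSum f ω :=
  Finset.sum_nonneg fun _ _ => hf _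

theorem exists_maximalRd_eq [Fintype K] (F : Heis K → ℂ) :
    ∃ σ : LineSelection K, ∀ ω, maximalRd F ω = σ.lineSum (fun p => ‖F p‖) ω := by
  have h : ∀ ω : refinedDirections K, ∃ (p : Heis K) (d : K × K), d ≠ 0 ∧
      (∃ h, ω.1 = Projectivization.mk K (d.1, d.2, p.x * d.2 - p.y * d.1) h) ∧
      maximalRd F ω = ∑ s : K, ‖F (p * horiz (s • d))‖ := by
    intro ω
    obtain ⟨L, ⟨p, a, b, h, hab, rfl, hω⟩, hL⟩ := (maximalRd_isGreatest F ω).1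
    exact ⟨p, (a, b), hab, ⟨h, hω⟩,
      hL.trans (finsum_mem_horizontalLine (fun p => ‖F p‖) p (h := (a, b)) hab)⟩
  choose base dir h1 h2 h3 using h
  exact ⟨⟨base, dir, h1, h2⟩, h3⟩

/-- A point of a selected line together with a direction vector of the line determines the
refined direction, hence the line, the scaling of the vector and the parameter of the point. -/
theorem injective_point_dir (σ : LineSelection K) :
    Function.Injective fun w : refinedDirections K × K × Kˣ =>
      (σ.base w.1 * horiz (w.2.1 • σ.dir w.1), (w.2.2 : K) • σ.dir w.1) := by
  rintro ⟨ω, s, l⟩ ⟨ω', s', l'⟩ h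
  obtain ⟨hp, hd⟩ := Prod.mk.inj h
  simp only at hp hd
  have hx := congrArg Heis.x hp
  have hy := congrArg Heis.y hp
  have ha := congrArg Prod.fst hd
  have hb := congrArg Prod.snd hd
  simp only [Heis.mul_x, Heis.mul_y, horiz, Prod.smul_fst, Prod.smul_snd, smul_eq_mul]
    at hx hy ha hb
  obtain ⟨h0, hω⟩ := σ.eq_mk ω
  obtain ⟨h0', hω'⟩ := σ.eq_mk ω'
  have hl : (l : K) ≠ 0 := l.ne_zero
  have key : ω = ω' := by
    apply Subtype.ext
    rw [hω, hω', Projectivization.mk_eq_mk_iff']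
    refine ⟨l' / l, ?_⟩
    simp only [Prod.smul_mk, smul_eq_mul, Prod.mk.injEq]
    have ha' : (l' / l : K) * (σ.dir ω').1 = (σ.dir ω).1 := by
      field_simp
      linear_combination -ha
    have hb' : (l' / l : K) * (σ.dir ω').2 = (σ.dir ω).2 := by
      field_simp
      linear_combination -hb
    refine ⟨ha', hb', ?_⟩
    linear_combination ((σ.base ω').x + s' * (σ.dir ω').1) * hb'
      - ((σ.base ω').y + s' * (σ.dir ω').2) * ha' - (σ.dir ω).2 * hx + (σ.dir ω).1 * hy
  subst key
  have h1 : (l : K) = l' := smul_left_injective K (σ.dir_ne_zero ω) hd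
  have h2 : s = s' := injective_mul_horiz_smul (σ.base ω) (σ.dir_ne_zero ω) hp
  rw [Units.ext h1, h2]

/-- Sums over the selected lines, with all points and all direction vectors of each line, are part
of the sum over all pairs of a point and a vector. -/
theorem sum_selection_le [Fintype K] [DecidableEq K] [Fintype (Heis K)]
    [Fintype (refinedDirections K)] (σ : LineSelection K) {Ψ : Heis K → K × K → ℝ}
    (hΨ : ∀ p h, 0 ≤ Ψ p h) :
    ∑ ω, ∑ s : K, ∑ l : Kˣ, Ψ (σ.base ω * horiz (s • σ.dir ω)) ((l : K) • σ.dir ω)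
      ≤ ∑ p, ∑ h, Ψ p h := by
  have := sum_comp_le_sum_of_injective σ.injective_point_dir
    (g := fun w : Heis K × K × K => Ψ w.1 w.2) fun w => hΨ _ _
  simpa only [Fintype.sum_prod_type, Fintype.sum_prod_type (f := fun w : Heis K × K × K => _)]
    using this

end LineSelection

section Card

theorem two_le_card (K : Type*) [Field K] [Fintype K] : (2 : ℝ) ≤ Fintype.card K := by
  exact_mod_cast Fintype.one_lt_card (α := K)

theorem card_heis (K : Type*) [Fintype K] [Fintype (Heis K)] :
    (Fintype.card (Heis K) : ℝ) = (Fintype.card K : ℝ) ^ 3 := by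
  rw [Fintype.card_congr (Heis.equivProd K)]
  simp
  ring

theorem card_refinedDirections_le (K : Type*) [Field K] [Fintype K] :
    (Nat.card (refinedDirections K) : ℝ) ≤ 2 * (Fintype.card K : ℝ) ^ 2 := by
  have h1 := Projectivization.card' K (K × K × K)
  have h2 : Nat.card (refinedDirections K) ≤ Nat.card (Projectivization K (K × K × K)) :=
    Nat.card_le_card_of_injective _ Subtype.val_injective
  have h3 : (Fintype.card K : ℝ) ^ 3
      = Nat.card (Projectivization K (K × K × K)) * ((Fintype.card K : ℝ) - 1) + 1 := by
    have := congrArg (Nat.cast : ℕ → ℝ) h1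
    rw [Nat.card_prod, Nat.card_prod, Nat.card_eq_fintype_card (α := K)] at this
    push_cast [Nat.cast_sub (Fintype.card_pos (α := K))] at this
    linarith
  have h2' : (Nat.card (refinedDirections K) : ℝ) ≤ Nat.card (Projectivization K (K × K × K)) := by
    exact_mod_cast h2
  have hq := two_le_card K
  nlinarith

end Card

namespace LineSelection

variable {K : Type*} [Field K] [Fintype K]

theorem card_units_real [DecidableEq K] :
    (Fintype.card Kˣ : ℝ) = Fintype.card K - 1 := by
  rw [Fintype.card_units, Nat.cast_sub Fintype.card_pos, Nat.cast_one]

/-- Log-convexity of sums of powers along a line: the exponent `1` lies between `r / 2` and `r`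
for `1 ≤ r ≤ 2`, with weights `2 - 2 / r` and `2 / r - 1`. -/
theorem lineSum_le_rpow_mul_rpow (σ : LineSelection K) {f : Heis K → ℝ} (hf : ∀ p, 0 ≤ f p)
    {r : ℝ} (h1 : 1 ≤ r) (h2 : r ≤ 2) (ω : refinedDirections K) :
    σ.lineSum f ω ≤ σ.lineSum (fun z => f z ^ (r / 2)) ω ^ (2 - 2 / r)
      * σ.lineSum (fun z => f z ^ r) ω ^ (2 / r - 1) := by
  have hr : 0 < r := by linarith
  have ha : 0 ≤ 2 - 2 / r := by rw [sub_nonneg, div_le_iff₀ hr]; linarith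
  have hb : 0 ≤ 2 / r - 1 := by rw [sub_nonneg, le_div_iff₀ hr]; linarith
  have h := sum_rpow_mul_rpow_le (Finset.univ : Finset K)
    (a := fun s => f (σ.base ω * horiz (s • σ.dir ω)) ^ (r / 2))
    (b := fun s => f (σ.base ω * horiz (s • σ.dir ω)) ^ r)
    (fun _ => Real.rpow_nonneg (hf _) _) (fun _ => Real.rpow_nonneg (hf _) _)
    ha (by linarith)
  have e : 1 - (2 - 2 / r) = 2 / r - 1 := by ring
  rw [e] at h
  refine le_trans (le_of_eq (Finset.sum_congr rfl fun s _ => ?_)) h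
  rw [← Real.rpow_mul (hf _), ← Real.rpow_mul (hf _), ← Real.rpow_add_of_nonneg (hf _)
    (by positivity) (by positivity)]
  have : r / 2 * (2 - 2 / r) + r * (2 / r - 1) = 1 := by field_simp; ring
  rw [this, Real.rpow_one]

variable [Fintype (Heis K)] [Fintype (refinedDirections K)]

theorem sum_lineSum_le (σ : LineSelection K) {f : Heis K → ℝ} (hf : ∀ p, 0 ≤ f p) :
    ∑ ω, σ.lineSum f ω ≤ 2 * (Fintype.card K : ℝ) * ∑ p, f p := by
  classical
  have h := σ.sum_selection_le (Ψ := fun p _ => f p) fun p _ => hf p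
  simp only [Finset.sum_const, Finset.card_univ, nsmul_eq_mul, card_units_real,
    ← Finset.mul_sum, Fintype.card_prod, Nat.cast_mul] at h
  change (_ - 1) * ∑ ω, σ.lineSum f ω ≤ _ at h
  have hq := two_le_card K
  have h0 : 0 ≤ ∑ ω, σ.lineSum f ω := Finset.sum_nonneg fun ω _ => σ.lineSum_nonneg hf ω
  have : (Fintype.card K : ℝ) * ∑ ω, σ.lineSum f ω
      ≤ Fintype.card K * (2 * Fintype.card K * ∑ p, f p) := by nlinarith
  exact le_of_mul_le_mul_left this (by linarith)

theorem sum_lineSum_sq_le_of_sum_eq_zero (σ : LineSelection K) {f : Heis K → ℝ}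
    (hf : ∑ p, f p = 0) :
    ∑ ω, σ.lineSum f ω ^ 2 ≤ 4 * (Fintype.card K : ℝ) * ∑ p, f p ^ 2 := by
  classical
  have h := (σ.sum_selection_le (Ψ := fun p h => (∑ s : K, f (p * horiz (s • h))) ^ 2)
    fun p _ => by positivity).trans (sum_sq_sum_line_le hf)
  -- the line through a point of a selected line along a multiple of its direction is that line
  have h1 : ∀ (ω : refinedDirections K) (s : K) (l : Kˣ),
      ∑ r : K, f (σ.base ω * horiz (s • σ.dir ω) * horiz (r • (l : K) • σ.dir ω))
        = σ.lineSum f ω := by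
    intro ω s l
    refine Fintype.sum_equiv ((Equiv.mulRight₀ (l : K) l.ne_zero).trans (Equiv.addLeft s)) _ _
      fun r => ?_
    congr 1
    rw [mul_assoc]
    congr 1
    ext <;> simp [horiz] <;> ring
  simp only [h1, Finset.sum_const, Finset.card_univ, nsmul_eq_mul, card_units_real,
    ← Finset.mul_sum] at h
  have hq := two_le_card K
  have h0 : 0 ≤ ∑ ω, σ.lineSum f ω ^ 2 := by positivity
  have h2 : (Fintype.card K : ℝ) / 2 * ∑ ω, σ.lineSum f ω ^ 2
      ≤ (Fintype.card K - 1) * ∑ ω, σ.lineSum f ω ^ 2 := by gcongr; linarith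
  have : (Fintype.card K : ℝ) ^ 2 * ∑ ω, σ.lineSum f ω ^ 2
      ≤ (Fintype.card K : ℝ) ^ 2 * (4 * Fintype.card K * ∑ p, f p ^ 2) := by
    have := mul_le_mul_of_nonneg_left h2 (by positivity : 0 ≤ (Fintype.card K : ℝ))
    linarith
  exact le_of_mul_le_mul_left this (by positivity)

/-- The `ℓ² → ℓ²` estimate with constant `q^{1/2}`, the critical case. The mean of `f` is split
off: on constants only the number `O(q²)` of selected lines matters. -/
theorem sum_lineSum_sq_le (σ : LineSelection K) (f : Heis K → ℝ) :
    ∑ ω, σ.lineSum f ω ^ 2 ≤ 12 * (Fintype.card K : ℝ) * ∑ p, f p ^ 2 := by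
  have hq := two_le_card K
  set q : ℝ := (Fintype.card K : ℝ) with hqdef
  set m : ℝ := (∑ p, f p) / q ^ 3 with hm
  have hmean : ∑ p, f p = q ^ 3 * m := by rw [hm]; field_simp
  have h0 : ∑ p, (f p - m) = 0 := by
    simp only [Finset.sum_sub_distrib, Finset.sum_const, Finset.card_univ, nsmul_eq_mul,
      card_heis, hmean]
    ring
  have h1 := σ.sum_lineSum_sq_le_of_sum_eq_zero h0
  have h2 : ∑ p, (f p - m) ^ 2 = ∑ p, f p ^ 2 - q ^ 3 * m ^ 2 := by
    have : ∀ p, (f p - m) ^ 2 = f p ^ 2 - 2 * m * f p + m ^ 2 := fun p => by ring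
    simp only [this, Finset.sum_add_distrib, Finset.sum_sub_distrib, ← Finset.mul_sum,
      Finset.sum_const, Finset.card_univ, nsmul_eq_mul, card_heis, hmean]
    ring
  have h3 : 0 ≤ ∑ p, (f p - m) ^ 2 := by positivity
  have h4 : ∀ ω, σ.lineSum f ω ^ 2 ≤ 2 * σ.lineSum (fun p => f p - m) ω ^ 2 + 2 * (q * m) ^ 2 := by
    intro ω
    have : σ.lineSum f ω = σ.lineSum (fun p => f p - m) ω + q * m := by
      simp [lineSum, hqdef]
    rw [this]
    nlinarith [sq_nonneg (σ.lineSum (fun p => f p - m) ω - q * m)]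
  have h5 := card_refinedDirections_le K
  rw [Nat.card_eq_fintype_card] at h5
  calc ∑ ω, σ.lineSum f ω ^ 2
      ≤ ∑ ω, (2 * σ.lineSum (fun p => f p - m) ω ^ 2 + 2 * (q * m) ^ 2) :=
        Finset.sum_le_sum fun ω _ => h4 ω
    _ = 2 * ∑ ω, σ.lineSum (fun p => f p - m) ω ^ 2
        + Fintype.card (refinedDirections K) * (2 * (q * m) ^ 2) := by
        simp [Finset.sum_add_distrib, Finset.mul_sum]
    _ ≤ 2 * (4 * q * ∑ p, (f p - m) ^ 2) + 2 * q ^ 2 * (2 * (q * m) ^ 2) := by gcongr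
    _ = 8 * q * ∑ p, f p ^ 2 - 4 * q * (q ^ 3 * m ^ 2) := by rw [h2]; ring
    _ ≤ 12 * q * ∑ p, f p ^ 2 := by
        have : 0 ≤ ∑ p, f p ^ 2 := by positivity
        have h6 : 0 ≤ q * (q ^ 3 * m ^ 2) := by positivity
        nlinarith

/-- Interpolation with the trivial `ℓ^∞ → ℓ^∞` bound. -/
theorem sum_lineSum_rpow_le_of_two_le (σ : LineSelection K) {f : Heis K → ℝ} (hf : ∀ p, 0 ≤ f p)
    {p : ℝ} (hp : 2 ≤ p) :
    ∑ ω, σ.lineSum f ω ^ p ≤ 12 * (Fintype.card K : ℝ) ^ (p - 1) * ∑ z, f z ^ p := by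
  have hq := two_le_card K
  have h1 : ∀ ω, σ.lineSum f ω ^ p
      ≤ (Fintype.card K : ℝ) ^ (p - 2) * σ.lineSum (fun z => f z ^ (p / 2)) ω ^ 2 := by
    intro ω
    have h := Real.rpow_sum_le_const_mul_sum_rpow_of_nonneg (s := (Finset.univ : Finset K))
      (f := fun s => f (σ.base ω * horiz (s • σ.dir ω))) (p := p / 2) (by linarith)
      fun _ _ => hf _
    have h2 := pow_le_pow_left₀ (by have := σ.lineSum_nonneg hf ω; positivity) h 2
    change (σ.lineSum f ω ^ (p / 2)) ^ 2 ≤ (_ * σ.lineSum (fun z => f z ^ (p / 2)) ω) ^ 2 at h2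
    rw [← Real.rpow_natCast, ← Real.rpow_mul (σ.lineSum_nonneg hf ω), mul_pow,
      ← Real.rpow_natCast (_ ^ (p / 2 - 1)), ← Real.rpow_mul (by positivity)] at h2
    have e1 : p / 2 * ((2 : ℕ) : ℝ) = p := by push_cast; ring
    have e2 : (p / 2 - 1) * ((2 : ℕ) : ℝ) = p - 2 := by push_cast; ring
    rwa [e1, e2, Finset.card_univ] at h2
  calc ∑ ω, σ.lineSum f ω ^ p
      ≤ ∑ ω, (Fintype.card K : ℝ) ^ (p - 2) * σ.lineSum (fun z => f z ^ (p / 2)) ω ^ 2 :=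
        Finset.sum_le_sum fun ω _ => h1 ω
    _ = (Fintype.card K : ℝ) ^ (p - 2) * ∑ ω, σ.lineSum (fun z => f z ^ (p / 2)) ω ^ 2 := by
        rw [Finset.mul_sum]
    _ ≤ (Fintype.card K : ℝ) ^ (p - 2) * (12 * Fintype.card K * ∑ z, (f z ^ (p / 2)) ^ 2) := by
        gcongr
        exact σ.sum_lineSum_sq_le _
    _ = 12 * (Fintype.card K : ℝ) ^ (p - 1) * ∑ z, f z ^ p := by
        have e1 : ∀ z, (f z ^ (p / 2)) ^ 2 = f z ^ p := fun z => by
          rw [← Real.rpow_natCast, ← Real.rpow_mul (hf z)]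
          congr 1
          push_cast
          ring
        have e2 : (Fintype.card K : ℝ) ^ (p - 1)
            = (Fintype.card K : ℝ) ^ (p - 2) * Fintype.card K := by
          rw [← Real.rpow_add_one (by positivity)]
          congr 1
          ring
        simp only [e1, e2]
        ring

theorem sum_lineSum_half_rpow_sq_le (σ : LineSelection K) {f : Heis K → ℝ} (hf : ∀ p, 0 ≤ f p)
    (r : ℝ) : ∑ ω, σ.lineSum (fun z => f z ^ (r / 2)) ω ^ 2
      ≤ 12 * (Fintype.card K : ℝ) * ∑ z, f z ^ r := by
  have e1 : ∀ z, (f z ^ (r / 2)) ^ 2 = f z ^ r := fun z => by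
    rw [← Real.rpow_natCast, ← Real.rpow_mul (hf z)]
    congr 1
    push_cast
    ring
  simpa only [e1] using σ.sum_lineSum_sq_le fun z => f z ^ (r / 2)

/-- Interpolation with the `ℓ¹ → ℓ¹` bound. -/
theorem sum_lineSum_rpow_le_of_le_two (σ : LineSelection K) {f : Heis K → ℝ} (hf : ∀ p, 0 ≤ f p)
    {r : ℝ} (h1 : 1 ≤ r) (h2 : r ≤ 2) :
    ∑ ω, σ.lineSum f ω ^ r ≤ 12 * (Fintype.card K : ℝ) * ∑ z, f z ^ r := by
  have hr : 0 < r := by linarith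
  have hfr : ∀ z, 0 ≤ f z ^ r := fun z => Real.rpow_nonneg (hf z) r
  have hfr2 : ∀ z, 0 ≤ f z ^ (r / 2) := fun z => Real.rpow_nonneg (hf z) _
  have hS : 0 ≤ ∑ z, f z ^ r := Finset.sum_nonneg fun z _ => hfr z
  have key : ∀ ω, σ.lineSum f ω ^ r
      ≤ (σ.lineSum (fun z => f z ^ (r / 2)) ω ^ 2) ^ (r - 1)
        * σ.lineSum (fun z => f z ^ r) ω ^ (1 - (r - 1)) := by
    intro ω
    have ha := σ.lineSum_nonneg hfr2 ω
    have hb := σ.lineSum_nonneg hfr ω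
    have h := Real.rpow_le_rpow (σ.lineSum_nonneg hf ω) (σ.lineSum_le_rpow_mul_rpow hf h1 h2 ω)
      hr.le
    rw [Real.mul_rpow (by positivity) (by positivity), ← Real.rpow_mul ha, ← Real.rpow_mul hb] at h
    rw [← Real.rpow_natCast, ← Real.rpow_mul ha]
    convert h using 3
    · push_cast; field_simp
    · field_simp; ring
  calc ∑ ω, σ.lineSum f ω ^ r
      ≤ (∑ ω, σ.lineSum (fun z => f z ^ (r / 2)) ω ^ 2) ^ (r - 1)
        * (∑ ω, σ.lineSum (fun z => f z ^ r) ω) ^ (1 - (r - 1)) :=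
        (Finset.sum_le_sum fun ω _ => key ω).trans
          (sum_rpow_mul_rpow_le _ (fun ω => sq_nonneg _) (fun ω => σ.lineSum_nonneg hfr ω)
            (by linarith) (by linarith))
    _ ≤ (12 * Fintype.card K * ∑ z, f z ^ r) ^ (r - 1)
        * (12 * Fintype.card K * ∑ z, f z ^ r) ^ (1 - (r - 1)) := by
        have h3 : ∑ ω, σ.lineSum (fun z => f z ^ r) ω ≤ 12 * Fintype.card K * ∑ z, f z ^ r :=
          (σ.sum_lineSum_le hfr).trans (by gcongr; norm_num)
        have h4 : 0 ≤ ∑ ω, σ.lineSum (fun z => f z ^ r) ω :=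
          Finset.sum_nonneg fun ω _ => σ.lineSum_nonneg hfr ω
        exact mul_le_mul
          (Real.rpow_le_rpow (by positivity) (σ.sum_lineSum_half_rpow_sq_le hf r) (by linarith))
          (Real.rpow_le_rpow h4 h3 (by linarith)) (by positivity) (by positivity)
    _ = 12 * Fintype.card K * ∑ z, f z ^ r := by
        rw [← Real.rpow_add_of_nonneg (by positivity) (by linarith) (by linarith)]
        simp

/-- Interpolation with the trivial `ℓ¹ → ℓ^∞` bound. -/
theorem sum_lineSum_rpow_conj_le (σ : LineSelection K) {f : Heis K → ℝ} (hf : ∀ p, 0 ≤ f p)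
    {r v : ℝ} (h2 : r ≤ 2) (hrv : r.HolderConjugate v) :
    ∑ ω, σ.lineSum f ω ^ v ≤ 12 * (Fintype.card K : ℝ) * (∑ z, f z ^ r) ^ (v / r) := by
  have hr : 0 < r := hrv.pos
  have hv : 0 < v := hrv.symm.pos
  have hfr : ∀ z, 0 ≤ f z ^ r := fun z => Real.rpow_nonneg (hf z) r
  have hfr2 : ∀ z, 0 ≤ f z ^ (r / 2) := fun z => Real.rpow_nonneg (hf z) _
  have hS : 0 ≤ ∑ z, f z ^ r := Finset.sum_nonneg fun z _ => hfr z
  have hv1 : v / r = v - 1 := by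
    have := hrv.symm.sub_one_mul_conj
    rw [div_eq_iff hr.ne', this]
  have hv2 : 2 ≤ v := by
    have h := hrv.inv_add_inv_eq_one
    have : (2 : ℝ)⁻¹ ≤ r⁻¹ := inv_anti₀ hr h2
    have : v⁻¹ ≤ (2 : ℝ)⁻¹ := by linarith
    exact (inv_le_inv₀ hv two_pos).1 this
  have key : ∀ ω, σ.lineSum f ω ^ v
      ≤ σ.lineSum (fun z => f z ^ (r / 2)) ω ^ 2 * (∑ z, f z ^ r) ^ (v - 2) := by
    intro ω
    have ha := σ.lineSum_nonneg hfr2 ω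
    have hb := σ.lineSum_nonneg hfr ω
    have h := Real.rpow_le_rpow (σ.lineSum_nonneg hf ω)
      (σ.lineSum_le_rpow_mul_rpow hf hrv.lt.le h2 ω) hv.le
    rw [Real.mul_rpow (by positivity) (by positivity), ← Real.rpow_mul ha, ← Real.rpow_mul hb] at h
    have e1 : (2 - 2 / r) * v = (2 : ℕ) := by
      push_cast
      linear_combination (-2 : ℝ) * hv1
    have e2 : (2 / r - 1) * v = v - 2 := by linear_combination (2 : ℝ) * hv1
    rw [e1, e2, Real.rpow_natCast] at h
    refine h.trans ?_
    have : σ.lineSum (fun z => f z ^ r) ω ≤ ∑ z, f z ^ r :=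
      sum_comp_le_sum_of_injective (injective_mul_horiz_smul (σ.base ω) (σ.dir_ne_zero ω)) hfr
    gcongr
  calc ∑ ω, σ.lineSum f ω ^ v
      ≤ (∑ ω, σ.lineSum (fun z => f z ^ (r / 2)) ω ^ 2) * (∑ z, f z ^ r) ^ (v - 2) := by
        rw [Finset.sum_mul]
        exact Finset.sum_le_sum fun ω _ => key ω
    _ ≤ 12 * Fintype.card K * (∑ z, f z ^ r) * (∑ z, f z ^ r) ^ (v - 2) := by
        gcongr
        exact σ.sum_lineSum_half_rpow_sq_le hf r
    _ = 12 * (Fintype.card K : ℝ) * (∑ z, f z ^ r) ^ (v / r) := by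
        rw [mul_assoc, hv1]
        congr 1
        nth_rewrite 1 [← Real.rpow_one (∑ z, f z ^ r)]
        rw [← Real.rpow_add_of_nonneg hS zero_le_one (by linarith)]
        congr 1
        ring

end LineSelection

/-! ### Upper bounds for the growth exponent -/

theorem one_le_natCard (K : Type*) [Field K] [Finite K] : (1 : ℝ) ≤ Nat.card K := by
  exact_mod_cast Nat.card_pos (α := K)

theorem norm_maximalRd {K : Type*} [Field K] [Finite K] (F : Heis K → ℂ)
    (ω : refinedDirections K) : ‖maximalRd F ω‖ = maximalRd F ω := by
  have := Fintype.ofFinite K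
  obtain ⟨σ, hσ⟩ := LineSelection.exists_maximalRd_eq F
  rw [hσ]
  exact Real.norm_of_nonneg (σ.lineSum_nonneg (fun _ => norm_nonneg _) ω)

namespace IsGrowthExponent

variable {u v : ℝ≥0∞} {A : ℝ}

theorem mono {B : ℝ} (hu : 1 ≤ u) (h : IsGrowthExponent u v A) (hAB : A ≤ B) :
    IsGrowthExponent u v B := by
  obtain ⟨C, hC, h⟩ := h
  refine ⟨C, hC, fun K _ _ F => (h K F).trans ?_⟩
  have := ellNorm_nonneg hu F
  have := one_le_natCard K
  gcongr

theorem of_le_left {u' : ℝ≥0∞} (hu' : 1 ≤ u') (h : IsGrowthExponent u v A) (huu : u' ≤ u) :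
    IsGrowthExponent u' v A := by
  obtain ⟨C, hC, h⟩ := h
  refine ⟨C, hC, fun K _ _ F => (h K F).trans ?_⟩
  have := ellNorm_anti hu' huu F
  gcongr

theorem of_le_right {v' : ℝ≥0∞} (hv : 1 ≤ v) (h : IsGrowthExponent u v A) (hvv : v ≤ v') :
    IsGrowthExponent u v' A := by
  obtain ⟨C, hC, h⟩ := h
  exact ⟨C, hC, fun K _ _ F => (ellNorm_anti hv hvv _).trans (h K F)⟩

/-- Hölder's inequality over the `O(q²)` refined directions. -/
theorem of_ge_right {v' : ℝ≥0∞} (hv' : 1 ≤ v') (h : IsGrowthExponent u v A) (hvv : v' ≤ v) :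
    IsGrowthExponent u v' (A + 2 * ((v'⁻¹).toReal - (v⁻¹).toReal)) := by
  obtain ⟨C, hC, h⟩ := h
  set δ := (v'⁻¹).toReal - (v⁻¹).toReal with hδ
  have hδ0 : 0 ≤ δ := by
    rw [hδ, sub_nonneg]
    exact ENNReal.toReal_mono (by simpa using (zero_lt_one.trans_le hv').ne')
      (ENNReal.inv_le_inv.2 hvv)
  refine ⟨2 ^ δ * C, by positivity, fun K _ _ F => ?_⟩
  have := Fintype.ofFinite K
  have hq := one_le_natCard K
  have hcard := card_refinedDirections_le K
  rw [← Nat.card_eq_fintype_card] at hcard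
  have hN := ellNorm_nonneg (hv'.trans hvv) (maximalRd F)
  calc ellNorm v' (maximalRd F)
      ≤ (Nat.card (refinedDirections K) : ℝ) ^ δ * ellNorm v (maximalRd F) :=
        ellNorm_le_card_rpow_mul hv' hvv _
    _ ≤ (2 * (Nat.card K : ℝ) ^ 2) ^ δ * (C * (Nat.card K : ℝ) ^ A * ellNorm u F) := by
        gcongr
        exact h K F
    _ = 2 ^ δ * C * (Nat.card K : ℝ) ^ (A + 2 * δ) * ellNorm u F := by
        rw [Real.mul_rpow (by positivity) (by positivity), ← Real.rpow_natCast,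
          ← Real.rpow_mul (by positivity), Real.rpow_add (by positivity)]
        push_cast
        ring

theorem top_top : IsGrowthExponent ∞ ∞ 1 := by
  refine ⟨1, one_pos, fun K _ _ F => ?_⟩
  have := Fintype.ofFinite K
  have hN := ellNorm_nonneg le_top F
  rw [ellNorm_top, one_mul, Real.rpow_one]
  refine Real.iSup_le (fun ω => ?_) (by positivity)
  obtain ⟨σ, hσ⟩ := LineSelection.exists_maximalRd_eq F
  rw [norm_maximalRd, hσ, Nat.card_eq_fintype_card]
  calc σ.lineSum (fun p => ‖F p‖) ω ≤ ∑ _s : K, ellNorm ∞ F :=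
        Finset.sum_le_sum fun s _ => norm_le_ellNorm le_top F _
    _ = _ := by simp

theorem one_top : IsGrowthExponent 1 ∞ 0 := by
  refine ⟨1, one_pos, fun K _ _ F => ?_⟩
  have := Fintype.ofFinite K
  have := Fintype.ofFinite (Heis K)
  have hN := ellNorm_nonneg le_rfl F
  rw [ellNorm_top, one_mul, Real.rpow_zero, one_mul]
  refine Real.iSup_le (fun ω => ?_) hN
  obtain ⟨σ, hσ⟩ := LineSelection.exists_maximalRd_eq F
  rw [norm_maximalRd, hσ, ellNorm_eq_sum le_rfl ENNReal.one_ne_top]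
  simpa using! sum_comp_le_sum_of_injective
    (injective_mul_horiz_smul (σ.base ω) (σ.dir_ne_zero ω)) fun p => norm_nonneg (F p)

/-- A bound for all line selections bounds the maximal function, since a selection of extremal
lines realizes it. -/
theorem of_sum_rpow_le (hu : 1 ≤ u) (hv : 1 ≤ v) (hv' : v ≠ ∞)
    (h : ∀ (K : Type) [Field K] [Fintype K] [Fintype (Heis K)] [Fintype (refinedDirections K)]
      (σ : LineSelection K) (F : Heis K → ℂ),
      ∑ ω, σ.lineSum (fun p => ‖F p‖) ω ^ v.toReal
        ≤ 12 * (Fintype.card K : ℝ) ^ (A * v.toReal) * ellNorm u F ^ v.toReal) :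
    IsGrowthExponent u v A := by
  have h0 : 0 < v.toReal := ENNReal.toReal_pos (zero_lt_one.trans_le hv).ne' hv'
  refine ⟨12 ^ (1 / v.toReal), by positivity, fun K _ _ F => ?_⟩
  have := Fintype.ofFinite K
  have := Fintype.ofFinite (Heis K)
  have := Fintype.ofFinite (refinedDirections K)
  have hN := ellNorm_nonneg hu F
  obtain ⟨σ, hσ⟩ := LineSelection.exists_maximalRd_eq F
  refine ellNorm_le_of_sum_rpow_le hv hv' (by positivity) ?_
  simp only [norm_maximalRd]
  simp only [hσ]
  refine (h K σ F).trans_eq ?_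
  rw [Real.mul_rpow (by positivity) hN, Real.mul_rpow (by positivity) (by positivity),
    ← Real.rpow_mul (by positivity), ← Real.rpow_mul (by positivity),
    one_div_mul_cancel h0.ne', Real.rpow_one, Nat.card_eq_fintype_card]

/-- The diagonal `u = v`: the exponent is `1 / u` for `u ≤ 2` and `1 - 1 / u` for `u ≥ 2`. -/
theorem diag (hu : 1 ≤ u) :
    IsGrowthExponent u u (max (u⁻¹).toReal (1 - (u⁻¹).toReal)) := by
  by_cases hu' : u = ∞
  · subst hu'
    exact top_top.mono le_top (by simp)
  have h0 : 0 < u.toReal := ENNReal.toReal_pos (zero_lt_one.trans_le hu).ne' hu'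
  have h1 : 1 ≤ u.toReal := by simpa using ENNReal.toReal_mono hu' hu
  rw [ENNReal.toReal_inv]
  rcases le_total u.toReal 2 with h2 | h2
  · refine IsGrowthExponent.mono hu (of_sum_rpow_le (A := (u.toReal)⁻¹) hu hu hu' ?_)
      (le_max_left _ _)
    intro K _ _ _ _ σ F
    rw [inv_mul_cancel₀ h0.ne', Real.rpow_one, ellNorm_rpow hu hu']
    exact σ.sum_lineSum_rpow_le_of_le_two (fun _ => norm_nonneg _) h1 h2
  · refine IsGrowthExponent.mono hu (of_sum_rpow_le (A := 1 - (u.toReal)⁻¹) hu hu hu' ?_)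
      (le_max_right _ _)
    intro K _ _ _ _ σ F
    rw [sub_mul, inv_mul_cancel₀ h0.ne', one_mul, ellNorm_rpow hu hu']
    exact σ.sum_lineSum_rpow_le_of_two_le (fun _ => norm_nonneg _) h2

/-- The segment `1 / u + 1 / v = 1`, `u ≤ 2`, from `ℓ¹ → ℓ^∞` to `ℓ² → ℓ²`. -/
theorem conj (hu : 1 ≤ u) (hu2 : u ≤ 2) (huv : u⁻¹ + v⁻¹ = 1) :
    IsGrowthExponent u v (v⁻¹).toReal := by
  have hu' : u ≠ ∞ := ne_top_of_le_ne_top ENNReal.ofNat_ne_top hu2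
  have hu0 : u ≠ 0 := (zero_lt_one.trans_le hu).ne'
  by_cases hu1 : u = 1
  · subst hu1
    have hv0 : v = ∞ := by simpa using huv
    subst hv0
    simpa using one_top
  have hv : 1 ≤ v := by
    rw [← ENNReal.inv_le_one, ← huv]
    exact le_add_self
  have hv0 : v ≠ 0 := (zero_lt_one.trans_le hv).ne'
  have hv' : v ≠ ∞ := by
    rintro rfl
    simp at huv
    exact hu1 huv
  have h0 : 0 < u.toReal := ENNReal.toReal_pos hu0 hu'
  have h0' : 0 < v.toReal := ENNReal.toReal_pos hv0 hv'
  have hc : u.toReal.HolderConjugate v.toReal := by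
    rw [Real.holderConjugate_iff]
    constructor
    · have := (ENNReal.toReal_lt_toReal ENNReal.one_ne_top hu').2 (lt_of_le_of_ne hu (Ne.symm hu1))
      simpa using this
    · rw [← ENNReal.toReal_inv, ← ENNReal.toReal_inv, ← ENNReal.toReal_add (by simpa) (by simpa),
        huv, ENNReal.toReal_one]
  have h2 : u.toReal ≤ 2 := by simpa using ENNReal.toReal_mono ENNReal.ofNat_ne_top hu2
  refine of_sum_rpow_le hu hv hv' ?_
  intro K _ _ _ _ σ F
  rw [ENNReal.toReal_inv, inv_mul_cancel₀ h0'.ne', Real.rpow_one, ellNorm_eq_sum hu hu',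
    ← Real.rpow_mul (by positivity), one_div_mul_eq_div]
  exact σ.sum_lineSum_rpow_conj_le (fun _ => norm_nonneg _) h2 hc

end IsGrowthExponent

theorem toReal_inv_anti {p r : ℝ≥0∞} (hp : 1 ≤ p) (hpr : p ≤ r) :
    (r⁻¹).toReal ≤ (p⁻¹).toReal :=
  ENNReal.toReal_mono (by simpa using (zero_lt_one.trans_le hp).ne') (ENNReal.inv_le_inv.2 hpr)

/-- The estimates on the diagonal `u = v` and on the line of duality `1/u + 1/v = 1`, `u ≤ 2`,
imply all others by the nesting of the `ℓ^p` norms and Hölder's inequality. -/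
theorem isGrowthExponent_max {u v : ℝ≥0∞} (hu : 1 ≤ u) (hv : 1 ≤ v) :
    IsGrowthExponent u v
      (max (v⁻¹).toReal
        (max (1 - (u⁻¹).toReal)
          (max (2 * (v⁻¹).toReal - (u⁻¹).toReal)
            (1 + 2 * (v⁻¹).toReal - 3 * (u⁻¹).toReal)))) := by
  have htwo : ((2 : ℝ≥0∞)⁻¹).toReal = 1 / 2 := by simp
  rcases le_total v u with huv | huv
  · -- above the diagonal, the third and fourth terms of the maximum dominate
    refine ((IsGrowthExponent.diag hu).of_ge_right hv huv).mono hu ?_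
    rcases max_cases (u⁻¹).toReal (1 - (u⁻¹).toReal) with ⟨h, -⟩ | ⟨h, -⟩ <;> rw [h]
    · exact le_max_of_le_right (le_max_of_le_right (le_max_of_le_left (by linarith)))
    · exact le_max_of_le_right (le_max_of_le_right (le_max_of_le_right (by linarith)))
  have conj_add : ∀ {p : ℝ≥0∞}, 1 ≤ p → p⁻¹ + (1 - p⁻¹) = 1 := fun hp =>
    add_tsub_cancel_of_le (ENNReal.inv_le_one.2 hp)
  rcases le_total 1 (u⁻¹ + v⁻¹) with h | h
  · refine IsGrowthExponent.mono (A := (v⁻¹).toReal) hu ?_ (le_max_left _ _)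
    rcases le_total v 2 with h2 | h2
    · refine ((IsGrowthExponent.diag hv).of_le_left hu huv).mono hu (max_le le_rfl ?_)
      have := toReal_inv_anti hv h2
      linarith
    · refine (IsGrowthExponent.conj (u := (1 - v⁻¹)⁻¹) ?_ ?_ ?_).of_le_left hu ?_
      · rw [ENNReal.one_le_inv]
        exact tsub_le_self
      · rw [ENNReal.inv_le_iff_inv_le]
        refine ENNReal.le_sub_of_add_le_left (by simpa using (zero_lt_one.trans_le hv).ne') ?_
        calc v⁻¹ + 2⁻¹ ≤ 2⁻¹ + 2⁻¹ := by gcongr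
          _ = 1 := ENNReal.inv_two_add_inv_two
      · rw [inv_inv, add_comm]
        exact conj_add hv
      · rw [ENNReal.le_inv_iff_le_inv, tsub_le_iff_right]
        exact h
  · refine IsGrowthExponent.mono (A := 1 - (u⁻¹).toReal) hu ?_
      (le_max_of_le_right (le_max_left _ _))
    rcases le_total u 2 with h2 | h2
    · have hv1 : (1 : ℝ≥0∞) ≤ (1 - u⁻¹)⁻¹ := by
        rw [ENNReal.one_le_inv]
        exact tsub_le_self
      have hc := IsGrowthExponent.conj (v := (1 - u⁻¹)⁻¹) hu h2
        (by rw [inv_inv]; exact conj_add hu)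
      rw [inv_inv, ENNReal.toReal_sub_of_le (ENNReal.inv_le_one.2 hu) ENNReal.one_ne_top,
        ENNReal.toReal_one] at hc
      refine hc.of_le_right hv1 ?_
      rw [ENNReal.inv_le_iff_inv_le]
      exact ENNReal.le_sub_of_add_le_left (by simpa using (zero_lt_one.trans_le hu).ne') h
    · refine ((IsGrowthExponent.diag hu).of_le_right hu huv).mono hu (max_le ?_ le_rfl)
      have := toReal_inv_anti (by norm_num) h2
      linarith

/-! ### Lower bounds for the growth exponent -/

/-- The refined direction `[m : 1 : c]`. -/
def affineDir {K : Type*} [Field K] (w : K × K) : refinedDirections K :=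
  ⟨Projectivization.mk K (w.1, 1, w.2) (by simp), w.1, 1, w.2, by simp, by simp, rfl⟩

theorem affineDir_injective {K : Type*} [Field K] :
    Function.Injective (affineDir : K × K → refinedDirections K) := by
  rintro ⟨m, c⟩ ⟨m', c'⟩ h
  have h1 := congrArg Subtype.val h
  simp only [affineDir] at h1
  rw [Projectivization.mk_eq_mk_iff'] at h1
  obtain ⟨a, ha⟩ := h1
  simp only [Prod.smul_mk, smul_eq_mul, mul_one, Prod.mk.injEq] at ha
  obtain ⟨h2, rfl, h3⟩ := ha
  simp_all

theorem sum_le_maximalRd {K : Type*} [Field K] [Fintype K] (F : Heis K → ℂ) (p : Heis K) (m : K) :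
    ∑ s : K, ‖F (p * horiz (s • (m, 1)))‖ ≤ maximalRd F (affineDir (m, p.x - p.y * m)) := by
  refine (maximalRd_isGreatest F _).2 ⟨horizontalLine p m 1, ?_, ?_⟩
  · refine ⟨p, m, 1, by simp, by simp, rfl, ?_⟩
    simp [affineDir]
  · exact (finsum_mem_horizontalLine (fun z => ‖F z‖) p (h := (m, 1)) (by simp)).symm

theorem one_le_maximalRd_indicator {K : Type*} [Field K] [Finite K] {S : Set (Heis K)} {p : Heis K}
    (hp : p ∈ S) (m : K) :
    1 ≤ maximalRd (S.indicator (1 : Heis K → ℂ)) (affineDir (m, p.x - p.y * m)) := by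
  have := Fintype.ofFinite K
  refine le_trans ?_ (sum_le_maximalRd _ p m)
  have := Finset.single_le_sum
    (f := fun s : K => ‖S.indicator (1 : Heis K → ℂ) (p * horiz (s • (m, 1)))‖)
    (fun _ _ => norm_nonneg _) (Finset.mem_univ 0)
  simpa [horiz_zero, hp] using this

theorem natCard_le_maximalRd_indicator {K : Type*} [Field K] [Finite K] {S : Set (Heis K)}
    {p : Heis K} {m : K} (hp : ∀ s : K, p * horiz (s • (m, 1)) ∈ S) :
    (Nat.card K : ℝ) ≤ maximalRd (S.indicator (1 : Heis K → ℂ)) (affineDir (m, p.x - p.y * m)) := by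
  have := Fintype.ofFinite K
  refine le_trans ?_ (sum_le_maximalRd _ p m)
  simp only [Set.indicator_of_mem (hp _)]
  simp

theorem le_of_forall_prime_rpow_le {a b C : ℝ}
    (h : ∀ p : ℕ, p.Prime → (p : ℝ) ^ a ≤ C * (p : ℝ) ^ b) : a ≤ b := by
  by_contra! hab
  have ht := (tendsto_rpow_atTop (sub_pos.2 hab)).comp (tendsto_natCast_atTop_atTop (R := ℝ))
  obtain ⟨N, hN⟩ := Filter.eventually_atTop.1 (ht.eventually_gt_atTop C)
  obtain ⟨p, hNp, hp⟩ := Nat.exists_infinite_primes N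
  have hp0 : (0 : ℝ) < p := by exact_mod_cast hp.pos
  have h1 : C < (p : ℝ) ^ (a - b) := hN p hNp
  rw [Real.rpow_sub hp0, lt_div_iff₀ (by positivity)] at h1
  exact absurd (h p hp) (not_le.2 h1)

/-- Testing on indicator functions: if a set of at most `q ^ d` points meets a line in at least
`q ^ n` points for `q ^ m` refined directions, then `n + m / v ≤ A + d / u`. -/
theorem IsGrowthExponent.le_of_indicator {u v : ℝ≥0∞} {A : ℝ} (hu : 1 ≤ u) (hv : 1 ≤ v)
    (hA : IsGrowthExponent u v A) (n m d : ℕ)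
    (H : ∀ (K : Type) [Field K] [Finite K], ∃ (S : Set (Heis K)) (ι : Type) (_ : Finite ι)
      (_ : Nonempty ι) (e : ι → refinedDirections K), Function.Injective e ∧
      S.ncard ≤ Nat.card K ^ d ∧ Nat.card ι = Nat.card K ^ m ∧
      ∀ i, (Nat.card K : ℝ) ^ n ≤ maximalRd (S.indicator (1 : Heis K → ℂ)) (e i)) :
    n + m * (v⁻¹).toReal ≤ A + d * (u⁻¹).toReal := by
  obtain ⟨C, hC, h⟩ := hA
  refine le_of_forall_prime_rpow_le (C := C) fun p hp => ?_
  have := Fact.mk hp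
  obtain ⟨S, ι, _, _, e, he, hS, hι, hM⟩ := H (ZMod p)
  have hp0 : (0 : ℝ) < p := by exact_mod_cast hp.pos
  simp only [Nat.card_zmod] at hS hι hM
  have h1 := mul_card_rpow_le_ellNorm hv he (by positivity)
    fun i => (hM i).trans (Real.le_norm_self _)
  have h2 := h1.trans (h (ZMod p) (S.indicator 1))
  have h3 : ellNorm u (S.indicator (1 : Heis (ZMod p) → ℂ)) ≤ ((p : ℝ) ^ d) ^ (u⁻¹).toReal := by
    refine (ellNorm_indicator_one_le hu S).trans ?_
    gcongr
    exact_mod_cast hS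
  have h4 := h2.trans (mul_le_mul_of_nonneg_left h3 (by positivity))
  rw [hι, Nat.card_zmod] at h4
  push_cast at h4
  rw [← Real.rpow_natCast_mul hp0.le, ← Real.rpow_natCast_mul hp0.le, mul_assoc,
    ← Real.rpow_add hp0, ← Real.rpow_natCast, ← Real.rpow_add hp0] at h4
  exact h4

theorem ncard_range_le {ι X : Type*} [Finite ι] (f : ι → X) :
    (Set.range f).ncard ≤ Nat.card ι := by
  rw [← Set.image_univ, ← Set.ncard_univ]
  exact Set.ncard_image_le

theorem max_le_of_isGrowthExponent {u v : ℝ≥0∞} {A : ℝ} (hu : 1 ≤ u) (hv : 1 ≤ v)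
    (hA : IsGrowthExponent u v A) :
    max (v⁻¹).toReal
        (max (1 - (u⁻¹).toReal)
          (max (2 * (v⁻¹).toReal - (u⁻¹).toReal)
            (1 + 2 * (v⁻¹).toReal - 3 * (u⁻¹).toReal))) ≤ A := by
  refine max_le ?_ (max_le ?_ (max_le ?_ ?_))
  · -- a single point
    have := hA.le_of_indicator hu hv 0 1 0 fun K _ _ =>
      ⟨{1}, K, inferInstance, inferInstance, fun m => affineDir (m, 0),
        fun m m' h => (Prod.mk.inj (affineDir_injective h)).1, by simp, by simp, fun m => by
          simpa using one_le_maximalRd_indicator (S := {1}) rfl m⟩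
    norm_num [-ENNReal.toReal_inv] at this
    linarith
  · -- a line, tested on its own direction
    have := hA.le_of_indicator hu hv 1 0 1 fun K _ _ =>
      ⟨Set.range fun s : K => horiz (s • (0, 1)), Unit, inferInstance, inferInstance,
        fun _ => affineDir (0, 0), fun _ _ _ => rfl, by simpa using ncard_range_le _, by simp,
        fun _ => by
          simpa using natCard_le_maximalRd_indicator (p := (1 : Heis K)) (m := 0)
            (S := Set.range fun s : K => horiz (s • ((0 : K), (1 : K)))) fun s => by simp⟩
    norm_num [-ENNReal.toReal_inv] at this
    linarith
  · -- a line, tested on the directions of the lines that meet it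
    have := hA.le_of_indicator hu hv 0 2 1 fun K _ _ =>
      ⟨Set.range fun s : K => ⟨s, 0, 0⟩, K × K, inferInstance, inferInstance,
        affineDir, affineDir_injective, by simpa using ncard_range_le _, by simp [sq],
        fun w => by
          simpa using one_le_maximalRd_indicator
            (S := Set.range fun s : K => (⟨s, 0, 0⟩ : Heis K)) ⟨w.2, rfl⟩ w.1⟩
    norm_num [-ENNReal.toReal_inv] at this
    linarith
  · -- the whole group
    have := hA.le_of_indicator hu hv 1 2 3 fun K _ _ =>
      ⟨Set.univ, K × K, inferInstance, inferInstance, affineDir, affineDir_injective, by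
          rw [Set.ncard_univ, Nat.card_congr (Heis.equivProd K), Nat.card_prod, Nat.card_prod]
          exact le_of_eq (by ring),
        by simp [sq], fun w => by
          simpa using natCard_le_maximalRd_indicator (S := Set.univ)
            (p := (⟨w.2, 0, 0⟩ : Heis K)) (m := w.1) fun _ => trivial⟩
    norm_num [-ENNReal.toReal_inv] at this
    linarith

end HeisKakeya

theorem theorem1p6 (u v : ℝ≥0∞) (hu : 1 ≤ u) (hv : 1 ≤ v) :
    IsLeast {A : ℝ | 0 ≤ A ∧ HeisKakeya.IsGrowthExponent u v A}
      (max (v⁻¹).toReal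
        (max (1 - (u⁻¹).toReal)
          (max (2 * (v⁻¹).toReal - (u⁻¹).toReal)
            (1 + 2 * (v⁻¹).toReal - 3 * (u⁻¹).toReal)))) :=
  ⟨⟨le_max_of_le_left ENNReal.toReal_nonneg, HeisKakeya.isGrowthExponent_max hu hv⟩,
    fun _ hA => HeisKakeya.max_le_of_isGrowthExponent hu hv hA.2⟩
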